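/- Let $BS(1,2)=\langle u,t \mid utu^{-1}=t^2\rangle$ be the Baumslag–Solitar group. A representation $\{U,T\}$ of $BS(1,2)$ on a complex Hilbert space $H$ is a pair of unitary operators $U,T$ on $H$ that are the images of $u,t$ under a unitary representation of $BS(1,2)$ on $H$; equivalently, $UTU^{-1}=T^2$. A vector $\psi\in H$ is called a Parseval wavelet for $\{U,T\}$ if the family $(U^jT^k\psi)_{(j,k)\in\mathbb{Z}^2}$ is a Parseval frame for $H$, that is, $$\|f\|^2=\sum_{j,k\in\mathbb{Z}}|\langle f,U^jT^k\psi\rangle|^2\qquad\text{for all } f\in H,$$ and it is called an orthonormal wavelet for $\{U,T\}$ if the indexed family $(U^jT^k\psi)_{(j,k)\in\mathbb{Z}^2}$ is an orthonormal basis of $H$. Theorem. Any Parseval wavelet can be dilated to an orthonormal wavelet. More precisely, let $\{U,T\}$ be a representation of $BS(1,2)$ on a complex Hilbert space $H$ and let $\psi\in H$ be a Parseval wavelet for $\{U,T\}$. Then there exist a complex Hilbert space $H_2$, a representation $\{U_2,T_2\}$ of $BS(1,2)$ on $H_2$, and a Parseval wavelet $\psi_2\in H_2$ for $\{U_2,T_2\}$,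 such that $\{U\oplus U_2,\,T\oplus T_2\}$ is a representation of $BS(1,2)$ on the Hilbert space direct sum $H\oplus H_2$ and $\psi\oplus\psi_2$ is an orthonormal wavelet for it. -/

import Mathlib

universe u

/-- The single relator `u t u⁻¹ t⁻²`; the generator `u` is `false` and the generator `t` is `true`. -/
def bsRelators : Set (FreeGroup Bool) :=
  {FreeGroup.of false * FreeGroup.of true * (FreeGroup.of false)⁻¹ * (FreeGroup.of true ^ 2)⁻¹}

/-- The Baumslag-Solitar group `BS(1,2) = ⟨u, t | u t u⁻¹ = t²⟩`. -/
abbrev BS12 : Type := PresentedGroup bsRelators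

/-- The generator `u` of `BS(1,2)`. -/
def BS12.u : BS12 := PresentedGroup.of false

/-- The generator `t` of `BS(1,2)`. -/
def BS12.t : BS12 := PresentedGroup.of true

/-- The pair of unitary operators `{U, T}` on `H` is a (unitary) representation of `BS(1,2)`: there
is a homomorphism from `BS(1,2)` to the unitary group of `H` with `u ↦ U` and `t ↦ T`. -/
def IsBSRep {H : Type*} [NormedAddCommGroup H] [InnerProductSpace ℂ H]
    (U T : H ≃ₗᵢ[ℂ] H) : Prop :=
  ∃ π : BS12 →* (H ≃ₗᵢ[ℂ] H), π BS12.u = U ∧ π BS12.t = T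

/-- `{U, T}` is a representation of `BS(1,2)` exactly when `U T U⁻¹ = T²`. -/
theorem isBSRep_iff {H : Type*} [NormedAddCommGroup H] [InnerProductSpace ℂ H]
    (U T : H ≃ₗᵢ[ℂ] H) : IsBSRep U T ↔ U * T * U⁻¹ = T ^ 2 := by
  constructor
  · rintro ⟨π, rfl, rfl⟩
    have h : BS12.u * BS12.t * BS12.u⁻¹ * (BS12.t ^ 2)⁻¹ = 1 :=
      PresentedGroup.one_of_mem (rels := bsRelators) (Set.mem_singleton _)
    have h' := mul_inv_eq_one.mp h
    rw [← map_inv, ← map_mul, ← map_mul, ← map_pow, h']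
  · intro h
    have hr : ∀ r ∈ bsRelators, FreeGroup.lift (fun b : Bool => if b then T else U) r = 1 := by
      intro r hr
      rw [bsRelators, Set.mem_singleton_iff] at hr
      subst hr
      simp [h]
    exact ⟨PresentedGroup.toGroup hr, by simp [BS12.u], by simp [BS12.t]⟩

/-- A Parseval frame: `‖f‖² = ∑ |⟨f, e_i⟩|²` for every `f` (with a convergent sum). -/
def IsParsevalFrame {ι H : Type*} [NormedAddCommGroup H] [InnerProductSpace ℂ H]
    (e : ι → H) : Prop :=
  ∀ f : H, HasSum (fun i => ‖inner ℂ (e i) f‖ ^ 2) (‖f‖ ^ 2)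

/-- An orthonormal (Hilbert) basis, as an indexed family. -/
def IsOrthonormalBasis {ι H : Type*} [NormedAddCommGroup H] [InnerProductSpace ℂ H]
    (e : ι → H) : Prop :=
  ∃ b : HilbertBasis ι ℂ H, ⇑b = e

/-- The family `U^j T^k ψ`, indexed by `(j, k) ∈ ℤ × ℤ`. -/
def waveletFamily {H : Type*} [NormedAddCommGroup H] [InnerProductSpace ℂ H]
    (U T : H ≃ₗᵢ[ℂ] H) (ψ : H) : ℤ × ℤ → H :=
  fun p => (U ^ p.1 * T ^ p.2) ψ

/-- `ψ` is a Parseval wavelet for `{U, T}`. -/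
def IsParsevalWavelet {H : Type*} [NormedAddCommGroup H] [InnerProductSpace ℂ H]
    (U T : H ≃ₗᵢ[ℂ] H) (ψ : H) : Prop :=
  IsParsevalFrame (waveletFamily U T ψ)

/-- `ψ` is an orthonormal wavelet for `{U, T}`. -/
def IsOrthonormalWavelet {H : Type*} [NormedAddCommGroup H] [InnerProductSpace ℂ H]
    (U T : H ≃ₗᵢ[ℂ] H) (ψ : H) : Prop :=
  IsOrthonormalBasis (waveletFamily U T ψ)

/-- The operator `A ⊕ B` on the Hilbert space direct sum `H₁ ⊕ H₂ = WithLp 2 (H₁ × H₂)`. -/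
noncomputable def directSumOp {H₁ H₂ : Type*} [NormedAddCommGroup H₁] [InnerProductSpace ℂ H₁]
    [NormedAddCommGroup H₂] [InnerProductSpace ℂ H₂]
    (A : H₁ ≃ₗᵢ[ℂ] H₁) (B : H₂ ≃ₗᵢ[ℂ] H₂) : WithLp 2 (H₁ × H₂) ≃ₗᵢ[ℂ] WithLp 2 (H₁ × H₂) :=
  LinearIsometryEquiv.withLpProdCongr 2 A B

/-! The analysis map of a Parseval frame `w` embeds `H` isometrically in `ℓ²`. Projecting the
standard basis onto the complement `N` of its range gives a Parseval frame `v` such that `w ⊕ v` is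
an orthonormal basis (`exists_complementary_parsevalFrame`). The Gram matrix of `v` is the identity
minus that of `w`, so it inherits the symmetries of a wavelet family.

The shift of `j` gives `U₂` on all of `N`. For `T₂`, the relation determines the action on the
vectors only at scales `j = -m ≤ 0`, where it is `k ↦ k + 2 ^ m`; this fixes `T₂` on the closed span
`V` of those vectors, and `V ⊆ U₂ V`. To pass from `V` to `U₂ V` one needs a square root of `U₂ T₂
U₂*` that agrees with `T₂` on `V`: keep `T₂` there and use on the complement a unitary root
respecting both subspaces (`exists_unitary_sqrt`, `IsRelationOn.exists_extension`). Iterating and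
gluing over the dense union of the `U₂ⁿ V` gives `T₂` (`IsRelationOn.exists_unitary`). -/

/-! ### Unitaries from equal Gram matrices. -/

theorem denseRange_linearCombination_of_orthogonal_eq_zero {ι E : Type*}
    [NormedAddCommGroup E] [InnerProductSpace ℂ E] [CompleteSpace E] (a : ι → E)
    (ha : ∀ x, (∀ i, inner ℂ (a i) x = 0) → x = 0) :
    DenseRange (Finsupp.linearCombination ℂ a) := by
  have : Dense ((Submodule.span ℂ (Set.range a) : Submodule ℂ E) : Set E) := by
    rw [Submodule.dense_iff_topologicalClosure_eq_top,
      Submodule.topologicalClosure_eq_top_iff, Submodule.eq_bot_iff]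
    intro x hx
    exact ha x fun i => hx (a i) (Submodule.subset_span ⟨i, rfl⟩)
  rwa [← Finsupp.range_linearCombination] at this

/-- Two families with dense spans and equal Gram matrices are intertwined by a unitary. -/
theorem exists_linearIsometryEquiv_of_gram_eq {ι E F : Type*}
    [NormedAddCommGroup E] [InnerProductSpace ℂ E] [CompleteSpace E]
    [NormedAddCommGroup F] [InnerProductSpace ℂ F] [CompleteSpace F]
    (a : ι → E) (b : ι → F) (hab : ∀ i j, inner ℂ (b i) (b j) = inner ℂ (a i) (a j))
    (ha : ∀ x, (∀ i, inner ℂ (a i) x = 0) → x = 0)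
    (hb : ∀ x, (∀ i, inner ℂ (b i) x = 0) → x = 0) :
    ∃ S : E ≃ₗᵢ[ℂ] F, ∀ i, S (a i) = b i := by
  have hnorm (x : ι →₀ ℂ) :
      ‖Finsupp.linearCombination ℂ b (LinearEquiv.refl ℂ (ι →₀ ℂ) x)‖ =
        ‖Finsupp.linearCombination ℂ a x‖ := by
    have : inner ℂ (Finsupp.linearCombination ℂ b x) (Finsupp.linearCombination ℂ b x) =
        inner ℂ (Finsupp.linearCombination ℂ a x) (Finsupp.linearCombination ℂ a x) := by
      simp only [Finsupp.linearCombination_apply, Finsupp.sum_inner, Finsupp.inner_sum,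
        inner_smul_left, inner_smul_right, hab]
    simp only [LinearEquiv.refl_apply, norm_eq_sqrt_re_inner (𝕜 := ℂ), this]
  refine ⟨(LinearEquiv.refl ℂ (ι →₀ ℂ)).extendOfIsometry _ _
    (denseRange_linearCombination_of_orthogonal_eq_zero a ha)
    (denseRange_linearCombination_of_orthogonal_eq_zero b hb) hnorm,
    fun i => ?_⟩
  have := LinearEquiv.extendOfIsometry_eq (LinearEquiv.refl ℂ (ι →₀ ℂ)) _ _
    (denseRange_linearCombination_of_orthogonal_eq_zero a ha)
    (denseRange_linearCombination_of_orthogonal_eq_zero b hb) hnorm (Finsupp.single i 1)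
  simpa using this

/-! ### Unitary square roots and the one-step extension. -/

section Operators

variable {H : Type*} [NormedAddCommGroup H] [InnerProductSpace ℂ H] [CompleteSpace H]

/-- Continuous linear maps agreeing on a family with dense span are equal. -/
theorem ContinuousLinearMap.ext_of_orthogonal_eq_zero {ι : Type*} (c : ι → H)
    (hc : ∀ x, (∀ i, inner ℂ (c i) x = 0) → x = 0) {X Y : H →L[ℂ] H}
    (h : ∀ i, X (c i) = Y (c i)) : X = Y := by
  have : star (X - Y) = 0 := by
    ext x
    refine hc _ fun i => ?_
    rw [star_eq_adjoint, adjoint_inner_right, sub_apply, h, sub_self, inner_zero_left]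
  simpa [sub_eq_zero] using congrArg star this

open ContinuousLinearMap in
/-- A unitary operator has a unitary square root which commutes with every self-adjoint operator
commuting with the given one. -/
theorem exists_unitary_sqrt (A : unitary (H →L[ℂ] H)) :
    ∃ S : unitary (H →L[ℂ] H), S * S = A ∧
      ∀ X : H →L[ℂ] H, IsSelfAdjoint X → Commute X A → Commute X S := by
  set D : H →L[ℂ] H := (A : H →L[ℂ] H) + 1 with hD
  -- The root is the polar phase of `D = A + 1`: on the circle, `1 + z` is a nonnegative multiple of
  -- a square root of `z`. At `z = -1`, the kernel of `D`, the phase is set to `i`.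
  have hAA : star (A : H →L[ℂ] H) * A = 1 := Unitary.coe_star_mul_self A
  have hAA' : (A : H →L[ℂ] H) * star (A : H →L[ℂ] H) = 1 := Unitary.coe_mul_star_self A
  have hAD : (A : H →L[ℂ] H) * star D = D := by simp [hD, mul_add, hAA', add_comm]
  have hDn : D * star D = star D * D := by
    simp only [hD, star_add, star_one, mul_add, add_mul, hAA, hAA']
    simp; abel
  set h : H →L[ℂ] H := CFC.abs D
  have hhh : h * h = star D * D := CFC.abs_mul_abs D
  have hhsa : star h = h := (CFC.abs_nonneg D).isSelfAdjoint
  set P : H →L[ℂ] H := (LinearMap.ker (D : H →ₗ[ℂ] H)).starProjection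
  have hPsa : star P = P := isSelfAdjoint_starProjection _
  have hPP : P * P = P := Submodule.isIdempotentElem_starProjection _
  have hker (x : H) : D x = 0 → P x = x := fun hx =>
    Submodule.starProjection_eq_self_iff.mpr hx
  have hDP : D * P = 0 := by
    ext x
    exact Submodule.starProjection_apply_mem (LinearMap.ker (D : H →ₗ[ℂ] H)) x
  have hDsP : star D * P = 0 := by
    have : star D = star (A : H →L[ℂ] H) * D := by simp [hD, mul_add, hAA, add_comm]
    rw [this, mul_assoc, hDP, mul_zero]
  have hPD : P * D = 0 := by simpa [hPsa] using congrArg star hDsP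
  have norm_sq (B : H →L[ℂ] H) (x : H) : inner ℂ (B x) (B x) = inner ℂ x ((star B * B) x) := by
    change _ = inner ℂ x (star B (B x))
    rw [star_eq_adjoint, adjoint_inner_right]
  have hhker (x : H) : h x = 0 ↔ D x = 0 := by
    rw [← inner_self_eq_zero (𝕜 := ℂ), norm_sq, hhsa, hhh, ← norm_sq, inner_self_eq_zero]
  have hhP : h * P = 0 := by
    ext x
    exact (hhker _).mpr (DFunLike.congr_fun hDP x)
  have hPh : P * h = 0 := by simpa [hPsa, hhsa] using congrArg star hhP
  -- Adding the kernel projection makes the modulus injective with dense range, so `S B = C`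
  -- determines `S`.
  set B : H →L[ℂ] H := h + P with hB
  set C : H →L[ℂ] H := D + Complex.I • P with hC
  have hBsa : star B = B := by simp [hB, hPsa, hhsa]
  have hBB : B * B = star D * D + P := by
    simp [hB, mul_add, add_mul, hhP, hPh, hPP, hhh]
  have hPDs : P * star D = 0 := by simpa [hPsa] using congrArg star hDP
  have hCC : star C * C = B * B := by
    rw [hBB]
    simp [hC, mul_add, add_mul, hPsa, hDsP, hPD, hPP, smul_smul]
  have hCC' : C * star C = B * B := by
    rw [hBB]
    simp [hC, mul_add, add_mul, hPsa, hDP, hPDs, hPP, hDn, smul_smul]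
  have hBinj (x : H) (hx : B x = 0) : x = 0 := by
    have h1 : P x = 0 := by
      have : (P * B) x = 0 := by simp [hx]
      simpa [hB, mul_add, hPh, hPP] using this
    have h2 : h x = 0 := by simpa [hB, h1] using hx
    rw [← hker x ((hhker x).mp h2), h1]
  have hBd (x : H) (hx : ∀ y, inner ℂ (B y) x = 0) : x = 0 := by
    refine hBinj x (ext_inner_left ℂ fun y => ?_)
    rw [← hBsa, star_eq_adjoint, adjoint_inner_right, hx, inner_zero_right]
  have hCd (x : H) (hx : ∀ y, inner ℂ (C y) x = 0) : x = 0 := by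
    have h1 : star C x = 0 := ext_inner_left ℂ fun y => by
      rw [star_eq_adjoint, adjoint_inner_right, hx, inner_zero_right]
    have h2 : (C * star C) x = 0 := by simp [h1]
    rw [hCC'] at h2
    exact hBinj _ (hBinj _ h2)
  obtain ⟨S, hS⟩ := exists_linearIsometryEquiv_of_gram_eq B C (fun x y => by
    rw [← adjoint_inner_right, ← adjoint_inner_right B, ← star_eq_adjoint, ← star_eq_adjoint]
    change inner ℂ x ((star C * C) y) = inner ℂ x ((star B * B) y)
    rw [hCC, hBsa]) hBd hCd
  set S' : H →L[ℂ] H := (Unitary.linearIsometryEquiv.symm S).1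
  have hSB : S' * B = C := by ext x; exact hS x
  have cancel (X Y : H →L[ℂ] H) (hXY : X * B = Y * B) : X = Y :=
    ContinuousLinearMap.ext_of_orthogonal_eq_zero B hBd fun y => DFunLike.congr_fun hXY y
  have comm (X : H →L[ℂ] H) (hXB : Commute X B) (hXC : Commute X C) : Commute X S' := by
    refine cancel _ _ ?_
    rw [mul_assoc, hSB, mul_assoc, hXB.eq, ← mul_assoc, hSB, hXC.eq]
  have hDh : Commute D h :=
    (Commute.cfcAbs_right (Commute.refl D) hDn)
  have hBC : Commute B C := by
    simp only [Commute, SemiconjBy, hB, hC, mul_add, add_mul, hPD, hDP, hDh.eq, hPh, hhP,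
      mul_smul_comm, smul_mul_assoc]
    simp
  have hSBc : Commute B S' := comm B (Commute.refl B) hBC
  refine ⟨Unitary.linearIsometryEquiv.symm S, Subtype.ext ?_, fun X hX hXA => ?_⟩
  · change S' * S' = A
    -- Both sides are compared after multiplication by `B * B`, which has dense range; `A D* = D`
    -- and `A P = -P` then suffice.
    refine cancel _ _ (cancel _ _ ?_)
    calc S' * S' * B * B = S' * (S' * B) * B := by noncomm_ring
      _ = (S' * B) * (S' * B) := by
        rw [hSB, mul_assoc, ← hBC.eq, ← mul_assoc, hSB]
      _ = D * D - P := by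
        rw [hSB]
        simp [hC, mul_add, add_mul, hPD, hDP, hPP, smul_smul, sub_eq_add_neg]
      _ = A * (B * B) := by
        rw [hBB, mul_add (A : H →L[ℂ] H), ← mul_assoc, hAD, sub_eq_add_neg, add_right_inj]
        have : (A : H →L[ℂ] H) = D - 1 := by simp [hD]
        rw [this, sub_mul, hDP]; simp
      _ = A * B * B := by noncomm_ring
  · have hXD : Commute X D := hXA.add_right (Commute.one_right X)
    have hXDs : Commute X (star D) := by simpa [hX.star_eq] using hXD.star_star
    have hXh : Commute X h :=
      (Commute.cfcAbs_left hXD.symm (by simpa [hX.star_eq] using hXD.symm)).symm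
    have hXP : Commute X P := by
      -- `X` preserves the kernel of `D`, and being self-adjoint it then reduces it.
      have h1 : P * X * P = X * P := by
        ext x
        refine hker _ ?_
        have : D * (X * P) = 0 := by rw [← mul_assoc, ← hXD.eq, mul_assoc, hDP, mul_zero]
        exact DFunLike.congr_fun this x
      have h2 : P * X * P = P * X := by
        simpa [hPsa, hX.star_eq, mul_assoc] using congrArg star h1
      exact h1.symm.trans h2
    exact comm X (hXh.add_right hXP) (hXD.add_right (hXP.smul_right _))

/-- The conditions on a unitary `T` to satisfy `U T U* = T²` on the range of a projection `p` which
reduces `T`. -/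
structure IsRelationOn (U : unitary (H →L[ℂ] H)) (p : H →L[ℂ] H) (T : unitary (H →L[ℂ] H)) :
    Prop where
  commute : Commute p (T : H →L[ℂ] H)
  relation : (U : H →L[ℂ] H) * T * star (U : H →L[ℂ] H) * p = T * T * p

/-- The hypothesis `hUp` says `p ≤ U p U*`. Only the restriction of `T` to the range of `p` is kept;
off it, `T` is replaced by a square root of `U T U*`. -/
theorem IsRelationOn.exists_extension {U T : unitary (H →L[ℂ] H)} {p : H →L[ℂ] H}
    (hp : IsStarProjection p)
    (hUp : (U : H →L[ℂ] H) * p * star (U : H →L[ℂ] H) * p = p) (h : IsRelationOn U p T) :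
    ∃ T' : unitary (H →L[ℂ] H),
      IsRelationOn U ((U : H →L[ℂ] H) * p * star (U : H →L[ℂ] H)) T' ∧
      (T' : H →L[ℂ] H) * p = T * p := by
  obtain ⟨S, hSS, hS⟩ := exists_unitary_sqrt (U * T * star U)
  obtain ⟨u, hu⟩ := U
  obtain ⟨t, ht⟩ := T
  obtain ⟨s, hs⟩ := S
  obtain ⟨hc, hr⟩ := h
  replace hSS : s * s = u * t * star u := congrArg Subtype.val hSS
  simp only [Unitary.coe_star, Submonoid.coe_mul] at *
  have hpp : p * p = p := hp.isIdempotentElem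
  have hps : star p = p := hp.isSelfAdjoint
  have huu : star u * u = 1 := (Unitary.mem_iff.mp hu).1
  have huu' : u * star u = 1 := (Unitary.mem_iff.mp hu).2
  have htt : star t * t = 1 := (Unitary.mem_iff.mp ht).1
  have htt' : t * star t = 1 := (Unitary.mem_iff.mp ht).2
  have hss : star s * s = 1 := (Unitary.mem_iff.mp hs).1
  have hss' : s * star s = 1 := (Unitary.mem_iff.mp hs).2
  set q := u * p * star u with hq
  have hqs : star q = q := by simp [hq, hps, mul_assoc]
  have hpq : p * q = p := by simpa [hps, hqs] using congrArg star hUp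
  have hpt : p * t = t * p := hc
  have hpts : p * star t = star t * p := by simpa [hps] using (congrArg star hpt).symm
  -- On the range of `p` the operator `u t u*` equals `t²`, which maps that range onto itself, so
  -- the range is reducing.
  have hpA : p * (u * t * star u) = u * t * star u * p := by
    have h1 : star (u * t * star u) * (u * t * star u) = 1 := by
      calc _ = u * star t * (star u * u) * t * star u := by
            simp only [star_mul, star_star]; noncomm_ring
        _ = u * (star t * t) * star u := by rw [huu]; noncomm_ring
        _ = 1 := by rw [htt, mul_one, huu']
    have h2 : t * t * p * star t * star t = p := by
      calc _ = t * (p * t) * star t * star t := by rw [hpt]; noncomm_ring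
        _ = t * p * (t * star t) * star t := by noncomm_ring
        _ = p := by rw [htt', mul_one, ← hpt, mul_assoc, htt', mul_one]
    have h3 : star (u * t * star u) * p = p * star t * star t := by
      calc _ = star (u * t * star u) * (t * t * p * star t * star t) := by rw [h2]
        _ = star (u * t * star u) * (u * t * star u) * p * star t * star t := by
            rw [← hr]; noncomm_ring
        _ = _ := by rw [h1, one_mul]
    have h4 : p * (u * t * star u) = t * t * p := by
      simpa only [star_mul, star_star, hps, mul_assoc] using congrArg star h3
    rw [h4, hr]
  have hqA : q * (u * t * star u) = u * t * star u * q := by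
    calc q * (u * t * star u) = u * p * (star u * u) * t * star u := by rw [hq]; noncomm_ring
      _ = u * (p * t) * star u := by rw [huu]; noncomm_ring
      _ = u * t * (star u * u) * p * star u := by rw [huu, hpt]; noncomm_ring
      _ = _ := by rw [hq]; noncomm_ring
  have hpS : p * s = s * p := hS p hps hpA
  have hqS : q * s = s * q := hS q hqs hqA
  have hpSs : p * star s = star s * p := by simpa [hps] using (congrArg star hpS).symm
  have hpc : p * (1 - p) = 0 := by rw [mul_sub, mul_one, hpp, sub_self]
  have hcp : (1 - p) * p = 0 := by rw [sub_mul, one_mul, hpp, sub_self]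
  have hcc : (1 - p) * (1 - p) = 1 - p := by rw [mul_sub, mul_one, hcp, sub_zero]
  have hcs : star (1 - p) = 1 - p := by simp [hps]
  have hcS : (1 - p) * s = s * (1 - p) := by rw [sub_mul, mul_sub, hpS]; simp
  have hcSs : (1 - p) * star s = star s * (1 - p) := by rw [sub_mul, mul_sub, hpSs]; simp
  have block (a b c d : H →L[ℂ] H) (hc1 : p * c = c * p) (hd : (1 - p) * d = d * (1 - p)) :
      (a * p + b * (1 - p)) * (c * p + d * (1 - p)) = a * c * p + b * d * (1 - p) := by
    have hpd : p * (d * (1 - p)) = 0 := by rw [← hd, ← mul_assoc, hpc, zero_mul]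
    have hpc' : (1 - p) * (c * p) = 0 := by rw [← hc1, ← mul_assoc, hcp, zero_mul]
    have hpp' : p * (c * p) = c * p := by rw [← mul_assoc, hc1, mul_assoc, hpp]
    have hdd : (1 - p) * (d * (1 - p)) = d * (1 - p) := by rw [← mul_assoc, hd, mul_assoc, hcc]
    rw [add_mul, mul_add, mul_add, mul_assoc a p, mul_assoc a p, hpp', hpd, mul_assoc b, hpc',
      mul_assoc b, hdd]
    simp [mul_assoc]
  -- Block diagonal for `p`; it squares to `u t u*` on the whole space, not just on the range of
  -- `q`.
  set r := t * p + s * (1 - p) with hrdef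
  have hrs : star r = star t * p + star s * (1 - p) := by
    rw [hrdef, star_add, star_mul, star_mul, hps, hcs, hpts, hcSs]
  have hrr : r * r = t * t * p + s * s * (1 - p) := block t s t s hpt hcS
  have hrp : r * p = t * p := by
    rw [hrdef, add_mul, mul_assoc, mul_assoc, hpp, hcp, mul_zero, add_zero]
  have hrA : r * r = u * t * star u := by
    rw [hrr, hSS, ← hr, ← mul_add, add_sub_cancel, mul_one]
  refine ⟨⟨r, Unitary.mem_iff.mpr ⟨?_, ?_⟩⟩, ⟨?_, ?_⟩, hrp⟩
  · rw [hrs, hrdef, block _ _ _ _ hpt hcS, htt, hss]; simp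
  · rw [hrs, hrdef, block _ _ _ _ hpts hcSs, htt', hss']; simp
  · change q * r = r * q
    have hqp : q * p = p := hUp
    have h1 : q * (t * p) = t * p := by rw [← hpt, ← mul_assoc, hqp]
    have h2 : t * p * q = t * p := by rw [mul_assoc, hpq]
    have h3 : (1 - p) * q = q * (1 - p) := by rw [sub_mul, mul_sub, hpq, hqp]; simp
    rw [hrdef, mul_add, add_mul, h1, h2, mul_assoc s _ q, h3, ← mul_assoc q s, hqS,
      mul_assoc s]
  · change u * r * star u * q = r * r * q
    calc _ = u * r * (star u * u) * p * star u := by rw [hq]; noncomm_ring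
      _ = u * (r * p) * star u := by rw [huu]; noncomm_ring
      _ = u * t * (star u * u) * p * star u := by rw [hrp, huu]; noncomm_ring
      _ = _ := by rw [hrA, hq]; noncomm_ring


end Operators

/-! ### Gluing the successive extensions. -/

section Operators

variable {H : Type*} [NormedAddCommGroup H] [InnerProductSpace ℂ H] [CompleteSpace H]

/-- A unitary `T₀` satisfying `U T₀ U* = T₀²` on the range of `p ≤ U p U*` extends from that range
to a unitary `T` with `U T U* = T²`, if the ranges of `Uⁿ p U*ⁿ` exhaust the space. -/
theorem IsRelationOn.exists_unitary {U T₀ : unitary (H →L[ℂ] H)} {p : H →L[ℂ] H}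
    (hp : IsStarProjection p)
    (hUp : (U : H →L[ℂ] H) * p * star (U : H →L[ℂ] H) * p = p) (h : IsRelationOn U p T₀)
    (hdense : ∀ x, (∀ (n : ℕ) (y : H), p y = y → inner ℂ (((U : H →L[ℂ] H) ^ n) y) x = 0) →
      x = 0) :
    ∃ T : H ≃ₗᵢ[ℂ] H, (∀ x, Unitary.linearIsometryEquiv U (T x) =
        T (T (Unitary.linearIsometryEquiv U x))) ∧
      ∀ x, p x = x → T x = (T₀ : H →L[ℂ] H) x := by
  set u : H →L[ℂ] H := U.1
  have huu : star u * u = 1 := Unitary.coe_star_mul_self U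
  set q : ℕ → H →L[ℂ] H := fun n => u ^ n * p * star u ^ n with hq
  have hq0 : q 0 = p := by simp [hq]
  have hqs (n : ℕ) : q (n + 1) = u * q n * star u := by
    simp only [hq]; rw [pow_succ', pow_succ]; noncomm_ring
  have hqp (n : ℕ) : IsStarProjection (q n) := by
    induction n with
    | zero => rwa [hq0]
    | succ n ih =>
      rw [hqs]
      refine ⟨?_, ?_⟩
      · change u * q n * star u * (u * q n * star u) = u * q n * star u
        calc _ = u * q n * (star u * u) * q n * star u := by noncomm_ring
          _ = u * (q n * q n) * star u := by rw [huu]; noncomm_ring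
          _ = _ := by rw [ih.isIdempotentElem]
      · change star (u * q n * star u) = _
        simp [ih.isSelfAdjoint.star_eq, mul_assoc]
  have hqq (n : ℕ) : u * q n * star u * q n = q n := by
    induction n with
    | zero => rwa [hq0]
    | succ n ih =>
      rw [hqs]
      calc _ = u * (u * q n * star u * (star u * u) * q n) * star u := by noncomm_ring
        _ = u * (u * q n * star u * q n) * star u := by rw [huu]; noncomm_ring
        _ = _ := by rw [ih]
  -- The hypothesis on `T` sits under the existential so that `choose` yields a total function to
  -- recurse with.
  have hstep : ∀ (n : ℕ) (T : unitary (H →L[ℂ] H)), ∃ T' : unitary (H →L[ℂ] H),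
      IsRelationOn U (q n) T →
        IsRelationOn U (q (n + 1)) T' ∧ T'.1 * q n = T.1 * q n := by
    intro n T
    by_cases hT : IsRelationOn U (q n) T
    · obtain ⟨T', h1, h2⟩ := hT.exists_extension (hqp n) (hqq n)
      exact ⟨T', fun _ => ⟨by rwa [hqs], h2⟩⟩
    · exact ⟨T, fun h => absurd h hT⟩
  choose g hg using hstep
  let R : ℕ → unitary (H →L[ℂ] H) := fun n => Nat.rec T₀ g n
  have hR (n : ℕ) : IsRelationOn U (q n) (R n) := by
    induction n with
    | zero => rw [hq0]; exact h
    | succ n ih => exact (hg n (R n) ih).1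
  have hRs (n : ℕ) : (R (n + 1)).1 * q n = (R n).1 * q n := (hg n (R n) (hR n)).2
  have hmono {n m : ℕ} (hnm : n ≤ m) {x : H} (hx : q n x = x) :
      q m x = x ∧ (R m).1 x = (R n).1 x := by
    induction m, hnm using Nat.le_induction with
    | base => exact ⟨hx, rfl⟩
    | succ m _ ih =>
      constructor
      · have := DFunLike.congr_fun (hqq m) x
        rw [← hqs] at this
        change q (m + 1) (q m x) = q m x at this
        rwa [ih.1] at this
      · have := DFunLike.congr_fun (hRs m) x
        change (R (m + 1)).1 (q m x) = (R m).1 (q m x) at this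
        rw [ih.1] at this
        rw [this, ih.2]
  have hRq (n : ℕ) (x : H) (hx : q n x = x) :
      q n ((R n).1 x) = (R n).1 x := by
    have := DFunLike.congr_fun (hR n).commute.eq x
    change q n ((R n).1 x) = (R n).1 (q n x) at this
    rwa [hx] at this
  have hRq' (n : ℕ) (x : H) (hx : q n x = x) :
      q n (star (R n).1 x) = star (R n).1 x := by
    have h1 : q n * star (R n).1 = star (R n).1 * q n := by
      simpa [(hqp n).isSelfAdjoint.star_eq] using (congrArg star (hR n).commute.eq).symm
    have := DFunLike.congr_fun h1 x
    change q n (star (R n).1 x) = star (R n).1 (q n x) at this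
    rwa [hx] at this
  have hdense' (x : H) (hx : ∀ (n : ℕ) (y : H), q n y = y → inner ℂ y x = 0) : x = 0 := by
    refine hdense x fun n y hy => hx n _ ?_
    have : q n * u ^ n = u ^ n * p := by
      have : star u ^ n * u ^ n = 1 := by
        rw [← star_pow]
        exact (Unitary.mem_iff.mp (pow_mem U.2 n)).1
      simp only [hq]
      rw [mul_assoc, this, mul_one]
    have := DFunLike.congr_fun this y
    change q n ((u ^ n) y) = (u ^ n) (p y) at this
    rwa [hy] at this
  -- Any two vectors lie in the range of a common `q`, where one unitary `R` acts on both, so Gram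
  -- entries agree. The images are total because each `R n` maps the range of `q n` onto itself.
  obtain ⟨T, hT⟩ := exists_linearIsometryEquiv_of_gram_eq
    (ι := {i : ℕ × H // q i.1 i.2 = i.2}) (fun i => i.1.2)
    (fun i => (R i.1.1).1 i.1.2)
    (fun i j => by
      obtain ⟨⟨n, x⟩, hx⟩ := i
      obtain ⟨⟨m, y⟩, hy⟩ := j
      dsimp only at *
      rw [← (hmono (le_max_left n m) hx).2, ← (hmono (le_max_right n m) hy).2]
      exact Unitary.inner_map_map _ _ _)
    (fun x hx => hdense' x fun n y hy => hx ⟨(n, y), hy⟩)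
    (fun x hx => hdense' x fun n y hy => by
      have := hx ⟨(n, star (R n).1 y), hRq' n y hy⟩
      have h1 := DFunLike.congr_fun (Unitary.coe_mul_star_self (R n)) y
      change (R n).1 (star (R n).1 y) = y at h1
      simpa only [h1] using this)
  have hT' (n : ℕ) (x : H) (hx : q n x = x) : T x = (R n).1 x := hT ⟨(n, x), hx⟩
  refine ⟨T, fun x => ?_, fun x hx => hT' 0 x (by rwa [hq0])⟩
  set T' : H →L[ℂ] H := (T : H →L[ℂ] H)
  have key : u * T' * star u = T' * T' := by
    -- For `x` in the range of `q n`, both `U* x` and `R n x` stay in that range, so `T` can be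
    -- replaced by `R n` throughout.
    refine ContinuousLinearMap.ext_of_orthogonal_eq_zero
      (fun i : {i : ℕ × H // q i.1 i.2 = i.2} => i.1.2)
      (fun x hx => hdense' x fun n y hy => hx ⟨(n, y), hy⟩) ?_
    rintro ⟨⟨n, x⟩, hx⟩
    dsimp only at *
    have h1 : q n (star u x) = star u x := by
      have : star u * q (n + 1) = q n * star u := by
        rw [hqs, ← mul_assoc, ← mul_assoc, huu, one_mul]
      have := DFunLike.congr_fun this x
      change star u (q (n + 1) x) = q n (star u x) at this
      rw [(hmono n.le_succ hx).1] at this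
      exact this.symm
    have h2 : u ((R n).1 (star u (q n x))) = (R n).1 ((R n).1 (q n x)) :=
      DFunLike.congr_fun (hR n).relation x
    rw [hx] at h2
    change u (T (star u x)) = T (T x)
    rw [hT' n _ h1, hT' n x hx, hT' n _ (hRq n x hx), h2]
  have h1 := DFunLike.congr_fun key (u x)
  have h2 : star u (u x) = x := DFunLike.congr_fun huu x
  change u (T (star u (u x))) = T (T (u x)) at h1
  rw [h2] at h1
  exact h1

end Operators

/-! ### Complementary Parseval frames. -/

/-- Since `θ* eᵢ = wᵢ`, the projection of `eᵢ` onto the complement of the range of `θ` is `eᵢ - θ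
wᵢ`. The last clause is the totality of `w ⊕ v`. -/
theorem exists_complementary_parsevalFrame {ι H : Type u} [NormedAddCommGroup H]
    [InnerProductSpace ℂ H] (w : ι → H) (hw : IsParsevalFrame w) :
    ∃ (N : Type u) (_ : NormedAddCommGroup N) (_ : InnerProductSpace ℂ N) (_ : CompleteSpace N)
      (v : ι → N), IsParsevalFrame v ∧
      (∀ i, inner ℂ (v i) (v i) = 1 - inner ℂ (w i) (w i)) ∧
      (∀ i j, i ≠ j → inner ℂ (v i) (v j) = - inner ℂ (w i) (w j)) ∧
      ∀ (f : H) (n : N), (∀ i, inner ℂ (w i) f + inner ℂ (v i) n = 0) → f = 0 ∧ n = 0 := by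
  classical
  have hmem (f : H) : Memℓp (fun i => inner ℂ (w i) f) 2 := by
    refine memℓp_gen ?_
    simpa using (hw f).summable
  let θ : H →ₗᵢ[ℂ] lp (fun _ : ι => ℂ) 2 :=
    { toFun f := ⟨fun i => inner ℂ (w i) f, hmem f⟩
      map_add' f g := by ext i; exact inner_add_right _ _ _
      map_smul' c f := by ext i; exact inner_smul_right _ _ _
      norm_map' f := by
        refine (sq_eq_sq₀ (norm_nonneg _) (norm_nonneg _)).mp ?_
        rw [← (hw f).tsum_eq]
        have := lp.norm_rpow_eq_tsum (p := 2) (by norm_num)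
          (⟨fun i => inner ℂ (w i) f, hmem f⟩ : lp (fun _ : ι => ℂ) 2)
        simpa using this }
  have hθ (f : H) (i : ι) : θ f i = inner ℂ (w i) f := rfl
  let e (i : ι) : lp (fun _ : ι => ℂ) 2 := lp.single 2 i (1 : ℂ)
  have he (i : ι) (x : lp (fun _ : ι => ℂ) 2) : inner ℂ (e i) x = x i := by
    simp [e, lp.inner_single_left]
  let N := (LinearMap.range θ.toLinearMap)ᗮ
  have hN (f : H) (n : N) : inner ℂ (θ f) (n : lp (fun _ : ι => ℂ) 2) = 0 := n.2 _ ⟨f, rfl⟩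
  let v (i : ι) : N := ⟨e i - θ (w i), by
    rintro _ ⟨f, rfl⟩
    change inner ℂ (θ f) _ = 0
    rw [inner_sub_right, θ.inner_map_map, ← inner_conj_symm, he, hθ, inner_conj_symm, sub_self]⟩
  have hv (i : ι) (n : N) : inner ℂ (v i) n = (n : lp (fun _ : ι => ℂ) 2) i := by
    change inner ℂ (e i - θ (w i)) (n : lp (fun _ : ι => ℂ) 2) = _
    rw [inner_sub_left, hN, sub_zero, he]
  have hvv (i j : ι) : inner ℂ (v i) (v j) = e j i - inner ℂ (w i) (w j) := hv i (v j)
  refine ⟨N, inferInstance, inferInstance, inferInstance, v, fun n => ?_, fun i => ?_,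
    fun i j hij => ?_, fun f n hfn => ?_⟩
  · simp only [hv]
    have := lp.hasSum_norm (p := 2) (by norm_num) (n : lp (fun _ : ι => ℂ) 2)
    simpa using this
  · rw [hvv]; simp [e]
  · rw [hvv]; simp [e, hij]
  · have h1 : θ f + n = 0 := by
      ext i
      simpa [hv, hθ] using hfn i
    have h2 : f = 0 := by
      have h3 : inner ℂ (θ f) (θ f) = 0 := by
        have := congrArg (inner ℂ (θ f)) h1
        rwa [inner_add_right, hN, add_zero, inner_zero_right] at this
      rwa [θ.inner_map_map, inner_self_eq_zero] at h3
    refine ⟨h2, Subtype.ext ?_⟩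
    simpa [h2] using h1

theorem IsParsevalFrame.eq_zero {ι H : Type*} [NormedAddCommGroup H] [InnerProductSpace ℂ H]
    {w : ι → H} (hw : IsParsevalFrame w) (x : H) (hx : ∀ i, inner ℂ (w i) x = 0) : x = 0 := by
  have := hw x
  simp only [hx, norm_zero, ne_eq, OfNat.ofNat_ne_zero, not_false_eq_true, zero_pow] at this
  simpa using this.unique hasSum_zero

theorem IsParsevalFrame.comp_equiv {ι κ H : Type*} [NormedAddCommGroup H] [InnerProductSpace ℂ H]
    {w : ι → H} (hw : IsParsevalFrame w) (σ : κ ≃ ι) : IsParsevalFrame (w ∘ σ) := fun f =>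
  (σ.hasSum_iff (f := fun i => ‖inner ℂ (w i) f‖ ^ 2)).mpr (hw f)

theorem LinearIsometryEquiv.zpow_apply_of_apply_eq_succ {H : Type*} [NormedAddCommGroup H]
    [InnerProductSpace ℂ H] (A : H ≃ₗᵢ[ℂ] H) (f : ℤ → H) (hf : ∀ n, A (f n) = f (n + 1))
    (n m : ℤ) : (A ^ n) (f m) = f (m + n) := by
  induction n with
  | zero => simp
  | succ n ih =>
    rw [zpow_add_one, (Commute.self_zpow A n).symm.eq]
    change A ((A ^ (n : ℤ)) (f m)) = _
    rw [ih, hf, add_assoc]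
  | pred n ih =>
    rw [zpow_sub_one, (Commute.self_zpow A _).symm.inv_right.eq]
    change A.symm ((A ^ (-n : ℤ)) (f m)) = _
    rw [ih, LinearIsometryEquiv.symm_apply_eq, hf]
    congr 1
    ring

/-! ### Direct sums and wavelet families. -/

section DirectSum

variable {H₁ H₂ : Type*} [NormedAddCommGroup H₁] [InnerProductSpace ℂ H₁]
  [NormedAddCommGroup H₂] [InnerProductSpace ℂ H₂]

theorem directSumOp_apply (A : H₁ ≃ₗᵢ[ℂ] H₁) (B : H₂ ≃ₗᵢ[ℂ] H₂) (x : H₁) (y : H₂) :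
    directSumOp A B (WithLp.toLp 2 (x, y)) = WithLp.toLp 2 (A x, B y) := rfl

theorem directSumOp_zpow_apply (A : H₁ ≃ₗᵢ[ℂ] H₁) (B : H₂ ≃ₗᵢ[ℂ] H₂) (n : ℤ) (x : H₁) (y : H₂) :
    (directSumOp A B ^ n) (WithLp.toLp 2 (x, y)) = WithLp.toLp 2 ((A ^ n) x, (B ^ n) y) := by
  have := (directSumOp A B).zpow_apply_of_apply_eq_succ
    (fun n => WithLp.toLp 2 ((A ^ n) x, (B ^ n) y)) (fun n => by
      rw [directSumOp_apply, add_comm, zpow_one_add, zpow_one_add]; rfl) n 0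
  simpa using this

theorem waveletFamily_directSumOp (U T : H₁ ≃ₗᵢ[ℂ] H₁) (U₂ T₂ : H₂ ≃ₗᵢ[ℂ] H₂) (x : H₁) (y : H₂)
    (i : ℤ × ℤ) : waveletFamily (directSumOp U U₂) (directSumOp T T₂) (WithLp.toLp 2 (x, y)) i =
      WithLp.toLp 2 (waveletFamily U T x i, waveletFamily U₂ T₂ y i) := by
  change (directSumOp U U₂ ^ i.1) ((directSumOp T T₂ ^ i.2) (WithLp.toLp 2 (x, y))) = _
  rw [directSumOp_zpow_apply, directSumOp_zpow_apply]
  rfl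

end DirectSum

theorem isBSRep_iff_apply {H : Type*} [NormedAddCommGroup H] [InnerProductSpace ℂ H]
    (U T : H ≃ₗᵢ[ℂ] H) : IsBSRep U T ↔ ∀ x, U (T x) = T (T (U x)) := by
  rw [isBSRep_iff, mul_inv_eq_iff_eq_mul, pow_two]
  exact ⟨fun h x => DFunLike.congr_fun h x, fun h => LinearIsometryEquiv.ext h⟩

theorem isBSRep_directSumOp {H₁ H₂ : Type*} [NormedAddCommGroup H₁] [InnerProductSpace ℂ H₁]
    [NormedAddCommGroup H₂] [InnerProductSpace ℂ H₂] {U T : H₁ ≃ₗᵢ[ℂ] H₁} {U₂ T₂ : H₂ ≃ₗᵢ[ℂ] H₂}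
    (h₁ : IsBSRep U T) (h₂ : IsBSRep U₂ T₂) :
    IsBSRep (directSumOp U U₂) (directSumOp T T₂) := by
  rw [isBSRep_iff_apply] at *
  intro x
  obtain ⟨x, y⟩ := x
  simp only [directSumOp_apply, h₁, h₂]

theorem apply_waveletFamily {H : Type*} [NormedAddCommGroup H]
    [InnerProductSpace ℂ H] (U T : H ≃ₗᵢ[ℂ] H) (ψ : H) (j k : ℤ) :
    U (waveletFamily U T ψ (j, k)) = waveletFamily U T ψ (j + 1, k) := by
  simp only [waveletFamily, add_comm j, zpow_one_add]
  rfl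

/-- Iterating the relation gives `U ^ m * T = T ^ (2 ^ m) * U ^ m`. At positive scales the same rule
would require roots of `T`, hence the restriction to `-m`. -/
theorem IsBSRep.apply_waveletFamily_right {H : Type*} [NormedAddCommGroup H]
    [InnerProductSpace ℂ H] {U T : H ≃ₗᵢ[ℂ] H} (h : IsBSRep U T) (ψ : H) (m : ℕ) (k : ℤ) :
    T (waveletFamily U T ψ (-m, k)) = waveletFamily U T ψ (-m, k + 2 ^ m) := by
  have h1 : T ^ 2 * U = U * T := by rw [← (isBSRep_iff U T).mp h]; group
  have key : T * U ^ (-m : ℤ) = U ^ (-m : ℤ) * T ^ (2 ^ m : ℤ) := by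
    have aux : U ^ m * T = T ^ (2 ^ m) * U ^ m := by
      induction m with
      | zero => simp
      | succ m ih =>
        have hc : SemiconjBy U T (T ^ 2) := h1.symm
        rw [pow_succ', mul_assoc, ih, ← mul_assoc, (hc.pow_right (2 ^ m)).eq, ← pow_mul,
          mul_assoc, pow_succ' 2 m]
    rw [zpow_neg, zpow_natCast, eq_inv_mul_iff_mul_eq, ← mul_assoc, aux, mul_inv_cancel_right]
    norm_cast
  simp only [waveletFamily]
  change (T * (U ^ (-m : ℤ) * T ^ k)) ψ = _
  rw [← mul_assoc, key, mul_assoc, ← zpow_add, add_comm]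

/-! ### Wavelet families recovered from Gram symmetries. -/

section Operators

variable {H : Type*} [NormedAddCommGroup H] [InnerProductSpace ℂ H]

theorem mem_span_range_orthogonal_iff {κ : Type*} (a : κ → H) (x : H) :
    x ∈ (Submodule.span ℂ (Set.range a))ᗮ ↔ ∀ i, inner ℂ (a i) x = 0 := by
  refine ⟨fun hx i => hx _ (Submodule.subset_span ⟨i, rfl⟩), fun hx y hy => ?_⟩
  induction hy using Submodule.span_induction with
  | mem _ h => obtain ⟨i, rfl⟩ := h; exact hx i
  | zero => exact inner_zero_left _
  | add _ _ _ _ h1 h2 => rw [inner_add_left, h1, h2, add_zero]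
  | smul c _ _ h => rw [inner_smul_left, h, mul_zero]

/-- A vector orthogonal to `a` is itself a member of the enlarged family. This lets a unitary be
prescribed on `a` and taken as the identity on its complement. -/
theorem eq_zero_of_orthogonal_elim {κ : Type*} (a : κ → H) (x : H)
    (hx : ∀ i, inner ℂ (Sum.elim a
      (fun y : {y : H // ∀ i, inner ℂ (a i) y = 0} => (y : H)) i) x = 0) : x = 0 :=
  inner_self_eq_zero.mp (hx (Sum.inr ⟨x, fun i => hx (Sum.inl i)⟩))

variable [CompleteSpace H]

/-- The orthogonal projection onto the closed linear span of a family. -/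
noncomputable def spanProjection {κ : Type*} (a : κ → H) : H →L[ℂ] H :=
  ((Submodule.span ℂ (Set.range a))ᗮ)ᗮ.starProjection

theorem spanProjection_apply_self {κ : Type*} (a : κ → H) (i : κ) :
    spanProjection a (a i) = a i :=
  Submodule.starProjection_eq_self_iff.mpr
    (Submodule.le_orthogonal_orthogonal _ (Submodule.subset_span ⟨i, rfl⟩))

theorem spanProjection_apply_eq_zero {κ : Type*} (a : κ → H) (x : H)
    (hx : ∀ i, inner ℂ (a i) x = 0) : spanProjection a x = 0 :=
  (Submodule.starProjection_apply_eq_zero_iff _).mpr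
    (Submodule.le_orthogonal_orthogonal _ ((mem_span_range_orthogonal_iff a x).mpr hx))

theorem isStarProjection_spanProjection {κ : Type*} (a : κ → H) :
    IsStarProjection (spanProjection a) :=
  ⟨Submodule.isIdempotentElem_starProjection _, isSelfAdjoint_starProjection _⟩

theorem ContinuousLinearMap.ext_of_eqOn_span_orthogonal {κ : Type*} (a : κ → H) {X Y : H →L[ℂ] H}
    (h : ∀ i, X (a i) = Y (a i)) (h' : ∀ x, (∀ i, inner ℂ (a i) x = 0) → X x = Y x) : X = Y :=
  ContinuousLinearMap.ext_of_orthogonal_eq_zero _ (eq_zero_of_orthogonal_elim a) (by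
    rintro (i | x)
    · exact h i
    · exact h' x x.2)

/-- A Gram-preserving permutation of a family is implemented by a unitary reducing its span. -/
theorem exists_unitary_of_gram_eq {κ : Type*} (a : κ → H) (σ : κ ≃ κ)
    (h : ∀ i j, inner ℂ (a (σ i)) (a (σ j)) = inner ℂ (a i) (a j)) :
    ∃ T : unitary (H →L[ℂ] H), Commute (spanProjection a) (T : H →L[ℂ] H) ∧
      ∀ i, (T : H →L[ℂ] H) (a i) = a (σ i) := by
  obtain ⟨T, hT⟩ := exists_linearIsometryEquiv_of_gram_eq
    (Sum.elim a fun y : {y : H // ∀ i, inner ℂ (a i) y = 0} => (y : H))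
    (Sum.elim (a ∘ σ) fun y : {y : H // ∀ i, inner ℂ (a i) y = 0} => (y : H)) (by
      rintro (i | x) (j | y)
      · exact h i j
      · exact (y.2 _).trans (y.2 _).symm
      · change inner ℂ (x : H) (a (σ j)) = inner ℂ (x : H) (a j)
        rw [← inner_conj_symm, x.2, ← inner_conj_symm, x.2]
      · rfl)
    (eq_zero_of_orthogonal_elim a)
    (fun x hx => eq_zero_of_orthogonal_elim a x (by
      rintro (i | y)
      · simpa using hx (Sum.inl (σ.symm i))
      · exact hx (Sum.inr y)))
  have h1 (i : κ) : T (a i) = a (σ i) := hT (Sum.inl i)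
  refine ⟨Unitary.linearIsometryEquiv.symm T, ?_, h1⟩
  refine ContinuousLinearMap.ext_of_eqOn_span_orthogonal a (fun i => ?_) (fun x hx => ?_)
  · change spanProjection a (T (a i)) = T (spanProjection a (a i))
    rw [spanProjection_apply_self, h1, spanProjection_apply_self]
  · change spanProjection a (T x) = T (spanProjection a x)
    have h2 : T x = x := hT (Sum.inr ⟨x, hx⟩)
    rw [h2, spanProjection_apply_eq_zero a x hx, map_zero]

/-- A family indexed by `ℤ × ℤ` with the Gram symmetries of a wavelet family is a wavelet family. -/
theorem exists_isBSRep_of_gram_symmetric (v : ℤ × ℤ → H)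
    (hv : ∀ x, (∀ i, inner ℂ (v i) x = 0) → x = 0)
    (hU : ∀ i i' : ℤ × ℤ, inner ℂ (v (i.1 + 1, i.2)) (v (i'.1 + 1, i'.2)) = inner ℂ (v i) (v i'))
    (hT : ∀ (m m' : ℕ) (k k' : ℤ), inner ℂ (v (-m, k + 2 ^ m)) (v (-m', k' + 2 ^ m')) =
      inner ℂ (v (-m, k)) (v (-m', k'))) :
    ∃ U T : H ≃ₗᵢ[ℂ] H, IsBSRep U T ∧ waveletFamily U T (v (0, 0)) = v := by
  obtain ⟨U, hUv⟩ := exists_linearIsometryEquiv_of_gram_eq v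
    (fun i => v (i.1 + 1, i.2)) hU hv
    (fun x hx => hv x fun i => by simpa using hx (i.1 - 1, i.2))
  let a (i : ℕ × ℤ) : H := v (-i.1, i.2)
  let σ : ℕ × ℤ ≃ ℕ × ℤ :=
    { toFun i := (i.1, i.2 + 2 ^ i.1)
      invFun i := (i.1, i.2 - 2 ^ i.1)
      left_inv i := by simp
      right_inv i := by simp }
  obtain ⟨T₀, hcomm, hT₀⟩ := exists_unitary_of_gram_eq a σ (fun i j => hT i.1 j.1 i.2 j.2)
  set p := spanProjection a
  have hUs (m : ℕ) (k : ℤ) : U.symm (v (-m, k)) = a (m + 1, k) := by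
    rw [LinearIsometryEquiv.symm_apply_eq, hUv]
    simp
  have hpz (x : H) (hx : ∀ i, inner ℂ (a i) x = 0) : p x = 0 := spanProjection_apply_eq_zero a x hx
  have hpa (i : ℕ × ℤ) : p (a i) = a i := spanProjection_apply_self a i
  have hUa (m : ℕ) (k : ℤ) : U (a (m + 1, k)) = a (m, k) := by
    rw [← hUs, LinearIsometryEquiv.apply_symm_apply]
  let U' : unitary (H →L[ℂ] H) := Unitary.linearIsometryEquiv.symm U
  have hU's (x : H) : star (U' : H →L[ℂ] H) x = U.symm x :=
    DFunLike.congr_fun U.adjoint_eq_symm x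
  -- `U⁻¹` lowers the scale, so it maps the span of the scales `j ≤ 0` into itself.
  have hUp : (U' : H →L[ℂ] H) * p * star (U' : H →L[ℂ] H) * p = p := by
    refine ContinuousLinearMap.ext_of_eqOn_span_orthogonal a (fun i => ?_) (fun x hx => ?_)
    · change U (p (star (U' : H →L[ℂ] H) (p (a i)))) = p (a i)
      rw [hpa, hU's, hUs, hpa, hUa]
    · change U (p (star (U' : H →L[ℂ] H) (p x))) = p x
      simp [hpz x hx]
  have hrel : IsRelationOn U' p T₀ := by
    refine ⟨hcomm, ContinuousLinearMap.ext_of_eqOn_span_orthogonal a (fun i => ?_) (fun x hx => ?_)⟩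
    · change U (T₀.1 (star (U' : H →L[ℂ] H) (p (a i)))) = T₀.1 (T₀.1 (p (a i)))
      rw [hpa, hU's, hUs, hT₀, hT₀, hT₀]
      change U (a (i.1 + 1, i.2 + 2 ^ (i.1 + 1))) = a (i.1, i.2 + 2 ^ i.1 + 2 ^ i.1)
      rw [hUa]
      congr 2
      ring
    · change U (T₀.1 (star (U' : H →L[ℂ] H) (p x))) = T₀.1 (T₀.1 (p x))
      simp [hpz x hx]
  have hUpow (j k n : ℤ) : (U ^ n) (v (j, k)) = v (j + n, k) :=
    U.zpow_apply_of_apply_eq_succ (fun j => v (j, k)) (fun j => hUv (j, k)) n j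
  obtain ⟨T, hT1, hT2⟩ := hrel.exists_unitary (isStarProjection_spanProjection a) hUp
    (fun x hx => hv x fun i => by
      -- With truncation, `j = j.toNat - (-j).toNat` covers both signs of `j`.
      have h1 := hx i.1.toNat (a ((-i.1).toNat, i.2)) (hpa _)
      have h2 (n : ℕ) (y : H) : ((U' : H →L[ℂ] H) ^ n) y = (U ^ (n : ℤ)) y := by
        induction n with
        | zero => simp
        | succ n ih =>
          rw [pow_succ', Nat.cast_succ, add_comm, zpow_one_add]
          change U (((U' : H →L[ℂ] H) ^ n) y) = U ((U ^ (n : ℤ)) y)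
          rw [ih]
      rw [h2, hUpow] at h1
      convert h1 using 3
      ext
      · simp; omega
      · rfl)
  refine ⟨U, T, (isBSRep_iff_apply U T).mpr hT1, funext fun i => ?_⟩
  have hT3 (k : ℤ) : T (v (0, k)) = v (0, k + 1) := by
    have h1 : v (0, k) = a (0, k) := by simp [a]
    rw [h1, hT2 _ (hpa _), hT₀]
    simp [a, σ]
  change (U ^ i.1) ((T ^ i.2) (v (0, 0))) = v i
  rw [T.zpow_apply_of_apply_eq_succ (fun k => v (0, k)) hT3, hUpow]
  simp

end Operators

/-! ### The dilation theorem. -/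

theorem mainTheorem1 {H : Type u} [NormedAddCommGroup H] [InnerProductSpace ℂ H]
    [CompleteSpace H] (U T : H ≃ₗᵢ[ℂ] H) (hUT : IsBSRep U T)
    (ψ : H) (hψ : IsParsevalWavelet U T ψ) :
    ∃ (H₂ : Type u) (_ : NormedAddCommGroup H₂) (_ : InnerProductSpace ℂ H₂)
      (_ : CompleteSpace H₂) (U₂ T₂ : H₂ ≃ₗᵢ[ℂ] H₂) (ψ₂ : H₂),
      IsBSRep U₂ T₂ ∧
      IsParsevalWavelet U₂ T₂ ψ₂ ∧
      IsBSRep (directSumOp U U₂) (directSumOp T T₂) ∧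
      IsOrthonormalWavelet (directSumOp U U₂) (directSumOp T T₂) (WithLp.toLp 2 (ψ, ψ₂)) := by
  set w := waveletFamily U T ψ with hw
  -- The index set is lifted to the universe of `H`, then brought back down.
  obtain ⟨N, _, _, _, v', hv', hdiag', hoff', htot'⟩ :=
    exists_complementary_parsevalFrame _ (IsParsevalFrame.comp_equiv hψ Equiv.ulift.{u})
  obtain ⟨v, rfl⟩ : ∃ v : ℤ × ℤ → N, v' = v ∘ Equiv.ulift :=
    ⟨v' ∘ Equiv.ulift.symm, by ext; simp⟩
  have hv : IsParsevalFrame v := hv'.comp_equiv Equiv.ulift.symm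
  have hdiag (i : ℤ × ℤ) : inner ℂ (v i) (v i) = 1 - inner ℂ (w i) (w i) := hdiag' ⟨i⟩
  have hoff (i j : ℤ × ℤ) (hij : i ≠ j) : inner ℂ (v i) (v j) = - inner ℂ (w i) (w j) :=
    hoff' ⟨i⟩ ⟨j⟩ (by simpa using hij)
  have htot (f : H) (n : N) (h : ∀ i, inner ℂ (w i) f + inner ℂ (v i) n = 0) : f = 0 ∧ n = 0 :=
    htot' f n fun i => h i.down
  -- Equality of indices must be preserved too, because of the identity matrix in the Gram matrix of
  -- `v`.
  have hgram (i j i' j' : ℤ × ℤ) (hij : i' = j' ↔ i = j)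
      (h : inner ℂ (w i') (w j') = inner ℂ (w i) (w j)) :
      inner ℂ (v i') (v j') = inner ℂ (v i) (v j) := by
    by_cases hc : i = j
    · obtain rfl := hc
      obtain rfl := hij.mpr rfl
      rw [hdiag, hdiag, h]
    · rw [hoff _ _ hc, hoff _ _ (mt hij.mp hc), h]
  obtain ⟨U₂, T₂, hUT₂, hfam⟩ := exists_isBSRep_of_gram_symmetric v hv.eq_zero
    (fun i i' => hgram _ _ _ _ (by simp [Prod.ext_iff]) (by
      rw [hw, ← apply_waveletFamily, ← apply_waveletFamily,
        U.inner_map_map]))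
    (fun m m' k k' => hgram _ _ _ _ (by
        simp only [Prod.ext_iff, neg_inj, Nat.cast_inj]
        exact and_congr_right fun h => by rw [h]; exact add_left_inj _) (by
      rw [hw, ← hUT.apply_waveletFamily_right, ← hUT.apply_waveletFamily_right,
        T.inner_map_map]))
  refine ⟨N, inferInstance, inferInstance, inferInstance, U₂, T₂, v (0, 0), hUT₂, ?_,
    isBSRep_directSumOp hUT hUT₂, ?_⟩
  · rwa [IsParsevalWavelet, hfam]
  · have hsum : waveletFamily (directSumOp U U₂) (directSumOp T T₂)
        (WithLp.toLp 2 (ψ, v (0, 0))) = fun i => WithLp.toLp 2 (w i, v i) := by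
      ext1 i
      rw [waveletFamily_directSumOp, hfam]
    rw [IsOrthonormalWavelet, hsum]
    have hinner (i : ℤ × ℤ) (x : WithLp 2 (H × N)) :
        inner ℂ (WithLp.toLp 2 (w i, v i)) x = inner ℂ (w i) x.fst + inner ℂ (v i) x.snd := rfl
    have horth : Orthonormal ℂ fun i => WithLp.toLp 2 (w i, v i) := by
      classical
      rw [orthonormal_iff_ite]
      intro i j
      rw [hinner]
      split_ifs with hij
      · subst hij
        change inner ℂ (w i) (w i) + inner ℂ (v i) (v i) = 1
        rw [hdiag]; ring
      · change inner ℂ (w i) (w j) + inner ℂ (v i) (v j) = 0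
        rw [hoff i j hij]; ring
    refine ⟨HilbertBasis.mkOfOrthogonalEqBot horth ?_, HilbertBasis.coe_mkOfOrthogonalEqBot _ _⟩
    rw [Submodule.eq_bot_iff]
    intro x hx
    obtain ⟨h1, h2⟩ := htot x.fst x.snd fun i => by
      rw [← hinner]
      exact hx _ (Submodule.subset_span ⟨i, rfl⟩)
    exact (WithLp.equiv 2 (H × N)).injective (Prod.ext h1 h2)
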